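/- Let $M$ be a connected (finite-dimensional, Hausdorff, boundaryless) smooth manifold. For a smooth function $f : M \to \mathbb{R}$ and a critical point $m$ of $f$, let $\operatorname{Hess}_m f$ denote the Hessian, a symmetric bilinear form on $T_m M$; the index (respectively co-index) of $f$ at $m$ is the number of negative (respectively positive) eigenvalues of $\operatorname{Hess}_m f$, counted with multiplicity. The function $f$ is called Morse–Bott if its critical set is a disjoint union of connected embedded submanifolds $\mathcal{C}_i$ of $M$ such that $\ker(\operatorname{Hess}_m f) = T_m \mathcal{C}_i$ for all $i$ and all $m \in \mathcal{C}_i$. Let $f : M \to \mathbb{R}$ be a proper Morse–Bott function such that the index and the co-index of $f$ at every critical point are both different from $1$. Then for every $c \in \mathbb{R}$ the level set $f^{-1}(c)$ is connected (the empty set being regarded as connected). -/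

import Mathlib

open scoped Manifold ContDiff

noncomputable section

namespace MorseBott

/-- The set of critical points of a real function on an `n`-dimensional manifold. -/
def criticalSet (n : ℕ) {M : Type*} [TopologicalSpace M]
    [ChartedSpace (EuclideanSpace ℝ (Fin n)) M] (f : M → ℝ) : Set M :=
  {m | mfderiv (𝓡 n) 𝓘(ℝ, ℝ) f m = 0}

/-- The function `f` read in the preferred chart at `m`. -/
def inChart (n : ℕ) {M : Type*} [TopologicalSpace M]
    [ChartedSpace (EuclideanSpace ℝ (Fin n)) M] (f : M → ℝ) (m : M) :
    EuclideanSpace ℝ (Fin n) → ℝ :=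
  fun x => f ((extChartAt (𝓡 n) m).symm x)

/-- The Hessian of `f` at `m`, as the second derivative at `m` of `f` read in the preferred chart
at `m`. This is the chart through which Mathlib identifies the tangent space at `m` with the
model space `EuclideanSpace ℝ (Fin n)`; at a critical point the bilinear form on the tangent space
obtained in this way does not depend on the chart. -/
def hessian (n : ℕ) {M : Type*} [TopologicalSpace M]
    [ChartedSpace (EuclideanSpace ℝ (Fin n)) M] (f : M → ℝ) (m : M) :
    EuclideanSpace ℝ (Fin n) →L[ℝ] EuclideanSpace ℝ (Fin n) →L[ℝ] ℝ :=
  fderiv ℝ (fderiv ℝ (inChart n f m)) (extChartAt (𝓡 n) m m)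

/-- The kernel of the Hessian: the tangent vectors `v` at `m` with `Hess_m f (v, w) = 0` for
all `w`. -/
def hessianKer (n : ℕ) {M : Type*} [TopologicalSpace M]
    [ChartedSpace (EuclideanSpace ℝ (Fin n)) M] (f : M → ℝ) (m : M) :
    Submodule ℝ (TangentSpace (𝓡 n) m) :=
  LinearMap.ker (hessian n f m).toLinearMap

/-- The quadratic form `v ↦ Hess_m f (v, v)`. -/
def hessianForm (n : ℕ) {M : Type*} [TopologicalSpace M]
    [ChartedSpace (EuclideanSpace ℝ (Fin n)) M] (f : M → ℝ) (m : M) :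
    QuadraticForm ℝ (EuclideanSpace ℝ (Fin n)) :=
  LinearMap.BilinMap.toQuadraticMap
    ((ContinuousLinearMap.coeLM ℝ).comp (hessian n f m).toLinearMap)

/-- The index of `f` at `m`: the number of negative eigenvalues of the Hessian, counted with
multiplicity (negative index of inertia). -/
def index (n : ℕ) {M : Type*} [TopologicalSpace M]
    [ChartedSpace (EuclideanSpace ℝ (Fin n)) M] (f : M → ℝ) (m : M) : ℕ :=
  _root_.sigNeg (hessianForm n f m)

/-- The co-index of `f` at `m`: the number of positive eigenvalues of the Hessian, counted with
multiplicity (positive index of inertia). -/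
def coindex (n : ℕ) {M : Type*} [TopologicalSpace M]
    [ChartedSpace (EuclideanSpace ℝ (Fin n)) M] (f : M → ℝ) (m : M) : ℕ :=
  _root_.sigPos (hessianForm n f m)

/-- A smooth function is Morse-Bott if its critical set is a disjoint union of connected embedded
submanifolds `C` (of possibly different dimensions) with `ker (Hess_m f) = T_m C` for all `m ∈ C`.
A smooth structure on the subspace `C` makes it an embedded submanifold when the inclusion is a
smooth embedding, and `T_m C` is then the range of the differential of the inclusion. -/
structure IsMorseBott (n : ℕ) {M : Type*} [TopologicalSpace M]
    [ChartedSpace (EuclideanSpace ℝ (Fin n)) M] (f : M → ℝ) : Prop where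
  contMDiff : ContMDiff (𝓡 n) 𝓘(ℝ, ℝ) ∞ f
  exists_critical_submanifolds : ∃ 𝒞 : Set (Set M),
    𝒞.PairwiseDisjoint id ∧ ⋃₀ 𝒞 = criticalSet n f ∧
    ∀ C ∈ 𝒞, IsConnected C ∧
      ∃ (k : ℕ) (_ : ChartedSpace (EuclideanSpace ℝ (Fin k)) C) (_ : IsManifold (𝓡 k) ∞ C),
        Manifold.IsSmoothEmbedding (𝓡 k) (𝓡 n) ∞ (Subtype.val : C → M) ∧
        ∀ m : C, hessianKer n f m.1 =
          LinearMap.range (mfderiv (𝓡 k) (𝓡 n) (Subtype.val : C → M) m).toLinearMap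

end MorseBott

end

open scoped Manifold ContDiff

namespace MorseBott

open Set Filter Topology

/-! The heart of the matter is that a separation of a slab `f ⁻¹' J`, with `J` an open interval, can
be pushed across any level. If some fiber were disconnected, properness would turn a separation of
that fiber into one of a thin slab around it. Zorn's lemma then enlarges the slab to all of `M`,
contradicting connectedness (`not_exists_separation`, `isPreconnected_fiber_of_tameBelow`).

Crossing the level `b` from below (`exists_extend_separation_above`) only requires that near each
point of the level the two pieces never meet. This is what `TameBelow` provides: small sublevel
traces are preconnected, so at most one piece accumulates at the point. The second clause makes the
choice of piece locally constant along the level. Crossing downwards is the same statement for `-f`.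

Tameness is checked in a chart. At a regular point the implicit function theorem reduces `f` to a
linear coordinate. At a critical point of index zero, the Morse-Bott condition forces a local
minimum (`IsMorseBott.eventually_le_of_index_eq_zero`), and the sublevel trace is empty. At index at
least two, the trace retracts along negative directions onto a sphere times a ball, which is
connected because the sphere has positive dimension (`isPreconnected_box_inter_sublevel`). Index one
is the excluded case, where this sphere is two points. The co-index plays the same role for `-f`. -/

/-- A local condition on the sublevel set of `f` at a point: its trace on small neighbourhoods of
`m` is preconnected, and being a local minimum is locally constant along the level set. -/
def TameBelow {M : Type*} [TopologicalSpace M] (f : M → ℝ) (m : M) : Prop :=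
  (∀ W ∈ 𝓝 m, ∃ U ∈ 𝓝 m, U ⊆ W ∧ IsPreconnected (U ∩ {y | f y < f m})) ∧
  ((∀ᶠ y in 𝓝 m, f m ≤ f y) ∨ ∀ᶠ y in 𝓝 m, f y = f m → y ∈ closure {z | f z < f m})

/-! ### Extending separations across levels of a proper tame function. -/

section Topology

variable {M : Type*} [TopologicalSpace M] {f : M → ℝ}

/-- A small preconnected sublevel trace that meets `U₂` lies entirely in `U₂`, so `U₁` stays away
from `m`. Since `U₂` accumulates at `m`, the point is not a local minimum; hence nearby points of
the level are limits of the sublevel set, and therefore of `U₂`. -/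
theorem TameBelow.of_mem_closure {m : M} (hm : TameBelow f m) {U₁ U₂ W : Set M}
    (h₁ : IsOpen U₁) (h₂ : IsOpen U₂) (hd : Disjoint U₁ U₂) (hW : W ∈ 𝓝 m)
    (hWU : W ∩ {y | f y < f m} ⊆ U₁ ∪ U₂) (hU₁ : U₁ ⊆ {y | f y < f m})
    (hU₂ : U₂ ⊆ {y | f y < f m}) (hmU : m ∈ closure U₂) :
    m ∉ closure U₁ ∧ ∀ᶠ y in 𝓝 m, f y = f m → y ∈ closure U₂ := by
  obtain ⟨hA, hB⟩ := hm
  obtain ⟨U, hU, hUW, hpre⟩ := hA W hW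
  have hsub : U ∩ {y | f y < f m} ⊆ U₂ := by
    refine hpre.subset_right_of_subset_union h₁ h₂ hd
      ((inter_subset_inter_left _ hUW).trans hWU) ?_
    obtain ⟨y, hyU, hy⟩ := mem_closure_iff_nhds.1 hmU U hU
    exact ⟨y, ⟨hyU, hU₂ hy⟩, hy⟩
  have hB' : ∀ᶠ y in 𝓝 m, f y = f m → y ∈ closure {z | f z < f m} := by
    refine hB.resolve_left fun h => ?_
    obtain ⟨y, hy, hy2⟩ := mem_closure_iff_nhds.1 hmU _ h
    exact absurd (show f y < f m from hU₂ hy2) (not_lt.2 hy)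
  constructor
  · intro hm1
    obtain ⟨y, hyU, hy1⟩ := mem_closure_iff_nhds.1 hm1 U hU
    exact disjoint_left.1 hd hy1 (hsub ⟨hyU, hU₁ hy1⟩)
  · filter_upwards [hB', eventually_mem_nhds_iff.2 hU] with y hy hyU hfy
    rw [mem_closure_iff_nhds]
    intro O hO
    obtain ⟨z, ⟨hzO, hzU⟩, hz⟩ := mem_closure_iff_nhds.1 (hy hfy) _ (inter_mem hO hyU)
    exact ⟨z, hzO, hsub ⟨hzU, hz⟩⟩

/-- A map to `ℝ` that is closed maps a neighbourhood of a fiber onto a neighbourhood. -/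
theorem exists_preimage_Ioo_subset (hf : IsClosedMap f) {b : ℝ} {W : Set M} (hW : IsOpen W)
    (hb : f ⁻¹' {b} ⊆ W) : ∃ ε > 0, f ⁻¹' Ioo (b - ε) (b + ε) ⊆ W := by
  have ho : IsOpen (f '' Wᶜ)ᶜ := (hf _ hW.isClosed_compl).isOpen_compl
  have hmem : b ∈ (f '' Wᶜ)ᶜ := by
    rintro ⟨x, hx, hxb⟩
    exact hx (hb hxb)
  obtain ⟨ε, hε, h⟩ := Metric.isOpen_iff.1 ho b hmem
  refine ⟨ε, hε, fun x hx => ?_⟩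
  by_contra hxW
  rw [Real.ball_eq_Ioo] at h
  exact h hx ⟨x, hxW, rfl⟩

/-- A separation of the part of `M` where `f` takes values in an interval `J` extends past the
upper end of `J`. -/
theorem exists_extend_separation_above [T2Space M] (hf : IsProperMap f)
    (htame : ∀ m, TameBelow f m) {J : Set ℝ} {a b : ℝ} (hab : a < b) (haJ : Ioo a b ⊆ J)
    (hJb : J ⊆ Iio b) {U₁ U₂ : Set M} (h₁ : IsOpen U₁) (h₂ : IsOpen U₂) (hd : Disjoint U₁ U₂)
    (hU : U₁ ∪ U₂ = f ⁻¹' J) :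
    ∃ ε > 0, ∃ V₁ V₂ : Set M, IsOpen V₁ ∧ IsOpen V₂ ∧ Disjoint V₁ V₂ ∧ U₁ ⊆ V₁ ∧ U₂ ⊆ V₂ ∧
      V₁ ∪ V₂ = f ⁻¹' (J ∪ Ioo (b - ε) (b + ε)) := by
  have hcont := hf.continuous
  have hcpt : IsCompact (f ⁻¹' {b}) := hf.isCompact_preimage isCompact_singleton
  have key : ∀ m ∈ f ⁻¹' {b}, m ∈ closure U₂ →
      m ∉ closure U₁ ∧ ∀ᶠ y in 𝓝 m, f y = b → y ∈ closure U₂ := by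
    intro m hm hmU
    obtain rfl : f m = b := hm
    refine (htame m).of_mem_closure h₁ h₂ hd
      ((isOpen_Ioi.preimage hcont).mem_nhds (show m ∈ f ⁻¹' Ioi a from hab)) ?_ ?_ ?_ hmU
    · rw [hU]
      exact fun y hy => haJ ⟨hy.1, hy.2⟩
    · exact fun y hy => hJb (hU.subset (Or.inl hy))
    · exact fun y hy => hJb (hU.subset (Or.inr hy))
  have hE₂ : IsCompact (f ⁻¹' {b} ∩ closure U₂) := hcpt.inter_right isClosed_closure
  -- Points of the level that neither piece approaches, such as local minima, are put on the side of
  -- `U₁`. The complement is closed because, by `key`, adherence to `U₂` is an open condition along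
  -- the level.
  have hE₁ : IsCompact (f ⁻¹' {b} \ closure U₂) := by
    refine hcpt.of_isClosed_subset ?_ sdiff_subset
    rw [← isOpen_compl_iff, isOpen_iff_mem_nhds]
    intro m hm
    by_cases hmb : f m = b
    · have hmU : m ∈ closure U₂ := by
        by_contra h
        exact hm ⟨hmb, h⟩
      filter_upwards [(key m hmb hmU).2] with y hy hy'
      exact hy'.2 (hy hy'.1)
    · filter_upwards [hcont.continuousAt.eventually_ne hmb] with y hy hy'
      exact hy hy'.1
  obtain ⟨W₁, W₂, hW₁, hW₂, hEW₁, hEW₂, hWd⟩ :=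
    SeparatedNhds.of_isCompact_isCompact hE₁ hE₂ (disjoint_left.2 fun x hx hx' => hx.2 hx'.2)
  have hcov : f ⁻¹' {b} ⊆ (W₁ \ closure U₂) ∪ (W₂ \ closure U₁) := by
    intro m hm
    by_cases hmU : m ∈ closure U₂
    · exact Or.inr ⟨hEW₂ ⟨hm, hmU⟩, (key m hm hmU).1⟩
    · exact Or.inl ⟨hEW₁ ⟨hm, hmU⟩, hmU⟩
  obtain ⟨ε, hε, hεW⟩ := exists_preimage_Ioo_subset hf.isClosedMap
    ((hW₁.sdiff isClosed_closure).union (hW₂.sdiff isClosed_closure)) hcov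
  have hI : IsOpen (f ⁻¹' Ioo (b - ε) (b + ε)) := isOpen_Ioo.preimage hcont
  refine ⟨ε, hε, U₁ ∪ (W₁ \ closure U₂) ∩ f ⁻¹' Ioo (b - ε) (b + ε),
    U₂ ∪ (W₂ \ closure U₁) ∩ f ⁻¹' Ioo (b - ε) (b + ε),
    h₁.union ((hW₁.sdiff isClosed_closure).inter hI),
    h₂.union ((hW₂.sdiff isClosed_closure).inter hI), ?_, subset_union_left, subset_union_left, ?_⟩
  · rw [disjoint_left]
    rintro x (hx | ⟨hx, -⟩) (hx' | ⟨hx', -⟩)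
    · exact disjoint_left.1 hd hx hx'
    · exact hx'.2 (subset_closure hx)
    · exact hx.2 (subset_closure hx')
    · exact disjoint_left.1 hWd hx.1 hx'.1
  · rw [preimage_union, ← hU]
    ext x
    constructor
    · rintro ((hx | hx) | (hx | hx))
      · exact Or.inl (Or.inl hx)
      · exact Or.inr hx.2
      · exact Or.inl (Or.inr hx)
      · exact Or.inr hx.2
    · rintro ((hx | hx) | hx)
      · exact Or.inl (Or.inl hx)
      · exact Or.inr (Or.inl hx)
      · exact (hεW hx).imp (fun h => Or.inr ⟨h, hx⟩) fun h => Or.inr ⟨h, hx⟩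

theorem exists_extend_separation_below [T2Space M] (hf : IsProperMap f)
    (htame : ∀ m, TameBelow (fun x => -f x) m) {J : Set ℝ} {a b : ℝ} (hab : b < a)
    (haJ : Ioo b a ⊆ J) (hJb : J ⊆ Ioi b) {U₁ U₂ : Set M} (h₁ : IsOpen U₁) (h₂ : IsOpen U₂)
    (hd : Disjoint U₁ U₂) (hU : U₁ ∪ U₂ = f ⁻¹' J) :
    ∃ ε > 0, ∃ V₁ V₂ : Set M, IsOpen V₁ ∧ IsOpen V₂ ∧ Disjoint V₁ V₂ ∧ U₁ ⊆ V₁ ∧ U₂ ⊆ V₂ ∧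
      V₁ ∪ V₂ = f ⁻¹' (J ∪ Ioo (b - ε) (b + ε)) := by
  obtain ⟨ε, hε, V₁, V₂, hV₁, hV₂, hVd, hUV₁, hUV₂, hV⟩ :=
    exists_extend_separation_above (f := fun x => -f x) (J := Neg.neg ⁻¹' J) (a := -a) (b := -b)
      ((Homeomorph.neg ℝ).isProperMap.comp hf) htame (neg_lt_neg hab)
      (fun x hx => haJ ⟨by linarith [hx.2], by linarith [hx.1]⟩)
      (fun x hx => by have := hJb hx; simp only [mem_Ioi, mem_Iio] at this ⊢; linarith)
      h₁ h₂ hd (by rw [hU]; ext x; simp)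
  refine ⟨ε, hε, V₁, V₂, hV₁, hV₂, hVd, hUV₁, hUV₂, ?_⟩
  rw [hV]
  ext x
  simp only [mem_preimage, mem_union, mem_Ioo, neg_neg]
  refine or_congr_right ⟨fun h => ⟨by linarith, by linarith⟩, fun h => ⟨by linarith, by linarith⟩⟩

/-- An open interval of `ℝ` that is not the whole line has an end. -/
theorem exists_end_of_isOpen_ordConnected {J : Set ℝ} (hJ : IsOpen J) (hJ' : J.OrdConnected)
    (hne : J.Nonempty) (huniv : J ≠ univ) :
    ∃ b ∉ J, (∃ a < b, Ioo a b ⊆ J ∧ J ⊆ Iio b) ∨ (∃ a > b, Ioo b a ⊆ J ∧ J ⊆ Ioi b) := by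
  obtain ⟨x, hx⟩ := (ne_univ_iff_exists_notMem J).1 huniv
  obtain ⟨c, hc⟩ := hne
  rcases lt_or_gt_of_ne (fun h : c = x => hx (h ▸ hc)) with hcx | hxc
  · have hbdd : BddAbove J := ⟨x, fun y hy => by
      by_contra! h
      exact hx (hJ'.out hc hy ⟨hcx.le, h.le⟩)⟩
    have hlub := isLUB_csSup ⟨c, hc⟩ hbdd
    have hnot : sSup J ∉ J := fun h => by
      obtain ⟨ε, hε, hb⟩ := Metric.isOpen_iff.1 hJ _ h
      have := hlub.1 (hb (show sSup J + ε / 2 ∈ Metric.ball (sSup J) ε by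
        rw [Real.ball_eq_Ioo]; constructor <;> linarith))
      linarith
    have hJlt : J ⊆ Iio (sSup J) := fun y hy =>
      lt_of_le_of_ne (hlub.1 hy) fun h => hnot (h ▸ hy)
    refine ⟨sSup J, hnot, Or.inl ⟨c, hJlt hc, fun y hy => ?_, hJlt⟩⟩
    obtain ⟨z, hz, hyz, -⟩ := hlub.exists_between hy.2
    exact hJ'.out hc hz ⟨hy.1.le, hyz.le⟩
  · have hbdd : BddBelow J := ⟨x, fun y hy => by
      by_contra! h
      exact hx (hJ'.out hy hc ⟨h.le, hxc.le⟩)⟩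
    have hglb := isGLB_csInf ⟨c, hc⟩ hbdd
    have hnot : sInf J ∉ J := fun h => by
      obtain ⟨ε, hε, hb⟩ := Metric.isOpen_iff.1 hJ _ h
      have := hglb.1 (hb (show sInf J - ε / 2 ∈ Metric.ball (sInf J) ε by
        rw [Real.ball_eq_Ioo]; constructor <;> linarith))
      linarith
    have hJlt : J ⊆ Ioi (sInf J) := fun y hy =>
      lt_of_le_of_ne (hglb.1 hy) fun h => hnot (h ▸ hy)
    refine ⟨sInf J, hnot, Or.inr ⟨c, hJlt hc, fun y hy => ?_, hJlt⟩⟩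
    obtain ⟨z, hz, -, hzy⟩ := hglb.exists_between hy.1
    exact hJ'.out hz hc ⟨hzy.le, hy.2.le⟩

/-- The part of `M` where a proper function takes values in an open interval cannot be separated
if `M` is connected and the function and its opposite are tame. -/
theorem not_exists_separation [T2Space M] [PreconnectedSpace M] (hf : IsProperMap f)
    (htame : ∀ m, TameBelow f m) (htame' : ∀ m, TameBelow (fun x => -f x) m) {J : Set ℝ}
    (hJ : IsOpen J) (hJ' : J.OrdConnected) (hJne : J.Nonempty) {U₁ U₂ : Set M} (h₁ : IsOpen U₁)
    (h₂ : IsOpen U₂) (hd : Disjoint U₁ U₂) (hU : U₁ ∪ U₂ = f ⁻¹' J) (hne₁ : U₁.Nonempty)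
    (hne₂ : U₂.Nonempty) : False := by
  let S : Set (Set ℝ × Set M × Set M) :=
    {p | IsOpen p.1 ∧ p.1.OrdConnected ∧ IsOpen p.2.1 ∧ IsOpen p.2.2 ∧ Disjoint p.2.1 p.2.2 ∧
      p.2.1 ∪ p.2.2 = f ⁻¹' p.1}
  have hS : (J, U₁, U₂) ∈ S := ⟨hJ, hJ', h₁, h₂, hd, hU⟩
  -- Separated slabs are ordered by inclusion in all three components; a chain is bounded by its
  -- componentwise union.
  obtain ⟨⟨J₀, V₁, V₂⟩, hle, hmax⟩ := zorn_le_nonempty₀ S (fun C hCS hC p hp => by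
    have hdir₁ : ∀ q ∈ C, ∀ r ∈ C, ∃ s ∈ C, q ≤ s ∧ r ≤ s := fun q hq r hr => by
      rcases hC.total hq hr with h | h
      exacts [⟨r, hr, h, le_rfl⟩, ⟨q, hq, le_rfl, h⟩]
    refine ⟨(⋃ q ∈ C, q.1, ⋃ q ∈ C, q.2.1, ⋃ q ∈ C, q.2.2), ⟨?_, ?_, ?_, ?_, ?_, ?_⟩, ?_⟩
    · exact isOpen_biUnion fun q hq => (hCS hq).1
    · refine ⟨fun x hx y hy => ?_⟩
      simp only [mem_iUnion₂] at hx hy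
      obtain ⟨q, hq, hxq⟩ := hx
      obtain ⟨r, hr, hyr⟩ := hy
      obtain ⟨s, hs, hqs, hrs⟩ := hdir₁ q hq r hr
      exact ((hCS hs).2.1.out (hqs.1 hxq) (hrs.1 hyr)).trans
        (subset_biUnion_of_mem (u := fun q : Set ℝ × Set M × Set M => q.1) hs)
    · exact isOpen_biUnion fun q hq => (hCS hq).2.2.1
    · exact isOpen_biUnion fun q hq => (hCS hq).2.2.2.1
    · rw [disjoint_left]
      intro x hx hy
      simp only [mem_iUnion₂] at hx hy
      obtain ⟨q, hq, hxq⟩ := hx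
      obtain ⟨r, hr, hyr⟩ := hy
      obtain ⟨s, hs, hqs, hrs⟩ := hdir₁ q hq r hr
      exact disjoint_left.1 (hCS hs).2.2.2.2.1 (hqs.2.1 hxq) (hrs.2.2 hyr)
    · simp only [preimage_iUnion₂, ← iUnion_union_distrib]
      exact iUnion₂_congr fun q hq => (hCS hq).2.2.2.2.2
    · intro q hq
      exact ⟨subset_biUnion_of_mem (u := fun q : Set ℝ × Set M × Set M => q.1) hq,
        subset_biUnion_of_mem (u := fun q : Set ℝ × Set M × Set M => q.2.1) hq,
        subset_biUnion_of_mem (u := fun q : Set ℝ × Set M × Set M => q.2.2) hq⟩) _ hS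
  obtain ⟨hJ₀, hJ₀', hV₁, hV₂, hVd, hV⟩ := hmax.prop
  have hext : ∀ b ∉ J₀, ∀ ε > 0, (J₀ ∪ Ioo (b - ε) (b + ε)).OrdConnected → ∀ V₁' V₂' : Set M,
      IsOpen V₁' → IsOpen V₂' → Disjoint V₁' V₂' → V₁ ⊆ V₁' → V₂ ⊆ V₂' →
      V₁' ∪ V₂' = f ⁻¹' (J₀ ∪ Ioo (b - ε) (b + ε)) → False := by
    intro b hb ε hε hoc V₁' V₂' hV₁' hV₂' hVd' hs₁ hs₂ hV'
    have hmem : (J₀ ∪ Ioo (b - ε) (b + ε), V₁', V₂') ∈ S :=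
      ⟨hJ₀.union isOpen_Ioo, hoc, hV₁', hV₂', hVd', hV'⟩
    have := hmax.le_of_ge hmem ⟨subset_union_left, hs₁, hs₂⟩
    exact hb (this.1 (Or.inr ⟨by linarith, by linarith⟩))
  have huniv : J₀ = univ := by
    by_contra hnu
    obtain ⟨b, hb, ⟨a, hab, haJ, hJb⟩ | ⟨a, hab, haJ, hJb⟩⟩ :=
      exists_end_of_isOpen_ordConnected hJ₀ hJ₀' (hJne.mono hle.1) hnu
    · obtain ⟨ε, hε, V₁', V₂', h⟩ :=
        exists_extend_separation_above hf htame hab haJ hJb hV₁ hV₂ hVd hV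
      refine hext b hb ε hε ?_ V₁' V₂' h.1 h.2.1 h.2.2.1 h.2.2.2.1 h.2.2.2.2.1 h.2.2.2.2.2
      -- A point common to `J₀` and the added interval makes their union an interval again.
      obtain ⟨t, ht⟩ : (Ioo (max a (b - ε)) b).Nonempty := nonempty_Ioo.2 (by simp [hab, hε])
      rw [mem_Ioo, max_lt_iff] at ht
      exact isPreconnected_iff_ordConnected.1 (IsPreconnected.union t (haJ ⟨ht.1.1, ht.2⟩)
        ⟨ht.1.2, by linarith [ht.2]⟩ (isPreconnected_iff_ordConnected.2 hJ₀') isPreconnected_Ioo)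
    · obtain ⟨ε, hε, V₁', V₂', h⟩ :=
        exists_extend_separation_below hf htame' hab haJ hJb hV₁ hV₂ hVd hV
      refine hext b hb ε hε ?_ V₁' V₂' h.1 h.2.1 h.2.2.1 h.2.2.2.1 h.2.2.2.2.1 h.2.2.2.2.2
      obtain ⟨t, ht⟩ : (Ioo b (min a (b + ε))).Nonempty := nonempty_Ioo.2 (by simp [hab, hε])
      rw [mem_Ioo, lt_min_iff] at ht
      exact isPreconnected_iff_ordConnected.1 (IsPreconnected.union t (haJ ⟨ht.1, ht.2.1⟩)
        ⟨by linarith [ht.1], ht.2.2⟩ (isPreconnected_iff_ordConnected.2 hJ₀') isPreconnected_Ioo)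
  rw [huniv, preimage_univ] at hV
  obtain ⟨x, -, hx₁, hx₂⟩ := isPreconnected_univ V₁ V₂ hV₁ hV₂ hV.ge
    (by simpa using hne₁.mono hle.2.1) (by simpa using hne₂.mono hle.2.2)
  exact disjoint_left.1 hVd hx₁ hx₂

/-- A splitting of the compact fiber has disjoint open neighbourhoods; since `f` is closed, these
cover a whole slab around the fiber, and `not_exists_separation` applies to that slab. -/
theorem isPreconnected_fiber_of_tameBelow [T2Space M] [PreconnectedSpace M] (hf : IsProperMap f)
    (htame : ∀ m, TameBelow f m) (htame' : ∀ m, TameBelow (fun x => -f x) m) (c : ℝ) :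
    IsPreconnected (f ⁻¹' {c}) := by
  have hcont := hf.continuous
  have hcpt : IsCompact (f ⁻¹' {c}) := hf.isCompact_preimage isCompact_singleton
  rw [isPreconnected_iff_subset_of_fully_disjoint_closed hcpt.isClosed]
  intro A B hA hB hAB hd
  by_contra! hcon
  obtain ⟨hnA, hnB⟩ := hcon
  obtain ⟨x, hx, hxA⟩ := not_subset.1 hnA
  obtain ⟨y, hy, hyB⟩ := not_subset.1 hnB
  obtain ⟨W₁, W₂, hW₁, hW₂, hAW, hBW, hWd⟩ :=
    SeparatedNhds.of_isCompact_isCompact (hcpt.inter_right hA) (hcpt.inter_right hB)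
      (hd.mono inter_subset_right inter_subset_right)
  obtain ⟨ε, hε, hεW⟩ := exists_preimage_Ioo_subset hf.isClosedMap (hW₁.union hW₂)
    (fun z hz => (hAB hz).imp (fun h => hAW ⟨hz, h⟩) fun h => hBW ⟨hz, h⟩)
  have hI : IsOpen (f ⁻¹' Ioo (c - ε) (c + ε)) := isOpen_Ioo.preimage hcont
  have hc : ∀ z ∈ f ⁻¹' {c}, z ∈ f ⁻¹' Ioo (c - ε) (c + ε) := fun z hz => by
    rw [mem_preimage, mem_singleton_iff.1 hz]
    constructor <;> linarith
  refine not_exists_separation (J := Ioo (c - ε) (c + ε)) hf htame htame' isOpen_Ioo ordConnected_Ioo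
    ⟨c, by linarith, by linarith⟩ (hW₁.inter hI) (hW₂.inter hI)
    (hWd.mono inter_subset_left inter_subset_left) ?_
    ⟨y, hAW ⟨hy, (hAB hy).resolve_right hyB⟩, hc y hy⟩
    ⟨x, hBW ⟨hx, (hAB hx).resolve_left hxA⟩, hc x hx⟩
  rw [← union_inter_distrib_right, inter_eq_right]
  exact hεW

end Topology

/-! ### Tameness under local homeomorphisms and at local minima. -/

section Transfer

variable {X Y : Type*} [TopologicalSpace X] [TopologicalSpace Y]

theorem TameBelow.of_openPartialHomeomorph (e : OpenPartialHomeomorph X Y) {x : X}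
    (hx : x ∈ e.source) {f : X → ℝ} {g : Y → ℝ} (hfg : ∀ y ∈ e.source, f y = g (e y))
    (hg : TameBelow g (e x)) : TameBelow f x := by
  have hxt : e x ∈ e.target := e.map_source hx
  constructor
  · intro W hW
    have hW' : e.target ∩ e.symm ⁻¹' W ∈ 𝓝 (e x) := by
      refine inter_mem (e.open_target.mem_nhds hxt) ((e.continuousAt_symm hxt).preimage_mem_nhds ?_)
      rwa [e.left_inv hx]
    obtain ⟨U, hU, hUW, hpre⟩ := hg.1 _ hW'
    have hUt : U ⊆ e.target := fun y hy => (hUW hy).1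
    refine ⟨e.symm '' U, ?_, ?_, ?_⟩
    · have := e.symm.image_mem_nhds hxt hU
      rwa [e.left_inv hx] at this
    · rintro _ ⟨y, hy, rfl⟩
      exact (hUW hy).2
    · have : e.symm '' U ∩ {y | f y < f x} = e.symm '' (U ∩ {y | g y < g (e x)}) := by
        ext z
        constructor
        · rintro ⟨⟨y, hy, rfl⟩, hz⟩
          refine ⟨y, ⟨hy, ?_⟩, rfl⟩
          rwa [mem_ofPred_eq, hfg _ hx, hfg _ (e.map_target (hUt hy)), e.right_inv (hUt hy)] at hz
        · rintro ⟨y, ⟨hy, hz⟩, rfl⟩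
          refine ⟨⟨y, hy, rfl⟩, ?_⟩
          rwa [mem_ofPred_eq, hfg _ hx, hfg _ (e.map_target (hUt hy)), e.right_inv (hUt hy)]
      rw [this]
      exact hpre.image _ (e.continuousOn_symm.mono (inter_subset_left.trans hUt))
  · have hsrc := e.open_source.mem_nhds hx
    refine hg.2.imp (fun h => ?_) fun h => ?_
    · filter_upwards [e.continuousAt hx h, hsrc] with y hy hys
      rw [hfg _ hx, hfg _ hys]
      exact hy
    · filter_upwards [e.continuousAt hx h, hsrc] with y hy hys hyx
      rw [hfg _ hx, hfg _ hys] at hyx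
      have hcl := hy hyx
      rw [mem_closure_iff_frequently, ← e.map_nhds_eq hys, frequently_map] at hcl
      rw [mem_closure_iff_frequently]
      refine (hcl.and_eventually (e.open_source.mem_nhds hys)).mono fun z hz => ?_
      rw [mem_ofPred_eq, hfg _ hx, hfg _ hz.2]
      exact hz.1

theorem tameBelow_of_eventually_le {f : X → ℝ} {x : X} (h : ∀ᶠ y in 𝓝 x, f x ≤ f y) :
    TameBelow f x := by
  refine ⟨fun W hW => ⟨W ∩ {y | f x ≤ f y}, inter_mem hW h, inter_subset_left, ?_⟩, Or.inl h⟩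
  convert isPreconnected_empty
  ext y
  simp only [mem_inter_iff, mem_ofPred_eq, mem_empty_iff_false, iff_false]
  exact fun hy => absurd hy.1.2 (not_le.2 hy.2)

end Transfer

/-! ### Tameness at regular points. -/

section Regular

variable {E : Type*} [NormedAddCommGroup E] [NormedSpace ℝ E]

theorem mem_closure_sublevel_of_hasFDerivAt {g : E → ℝ} {g' : E →L[ℝ] ℝ} {x : E}
    (hg : HasFDerivAt g g' x) (hne : g' ≠ 0) : x ∈ closure {z | g z < g x} := by
  by_contra h
  rw [mem_closure_iff_frequently, not_frequently] at h
  have hmin : IsLocalMin g x := h.mono fun y hy => not_lt.1 hy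
  exact hne (hmin.hasFDerivAt_eq_zero hg)

theorem tameBelow_fst (p : ℝ × E) : TameBelow (Prod.fst : ℝ × E → ℝ) p := by
  refine ⟨fun W hW => ?_, Or.inr (Eventually.of_forall fun y hy => ?_)⟩
  · obtain ⟨ε, hε, hεW⟩ := Metric.mem_nhds_iff.1 hW
    refine ⟨Metric.ball p ε, Metric.ball_mem_nhds _ hε, hεW, Convex.isPreconnected ?_⟩
    exact (convex_ball p ε).inter
      (convex_halfSpace_lt (LinearMap.fst ℝ ℝ E).isLinear p.1)
  · have := mem_closure_sublevel_of_hasFDerivAt (x := y) (hasFDerivAt_fst (𝕜 := ℝ) (E := ℝ) (F := E))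
      (fun h => by simpa using congrArg (fun L => L ((1 : ℝ), (0 : E))) h)
    rwa [hy] at this

/-- The implicit function theorem supplies a local homeomorphism carrying `g` to a first projection,
whose sublevel sets are half-spaces. -/
theorem tameBelow_of_hasStrictFDerivAt [FiniteDimensional ℝ E] {g : E → ℝ} {g' : E →L[ℝ] ℝ}
    {x : E} (hg : HasStrictFDerivAt g g' x) (hne : g' ≠ 0) : TameBelow g x := by
  have : CompleteSpace E := FiniteDimensional.complete ℝ E
  have hsurj : g'.range = ⊤ := by
    refine LinearMap.range_eq_top.2 (LinearMap.surjective fun h => hne ?_)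
    ext v
    exact LinearMap.congr_fun h v
  exact .of_openPartialHomeomorph (hg.implicitToOpenPartialHomeomorph g g' hsurj)
    (hg.mem_implicitToOpenPartialHomeomorph_source hsurj)
    (fun y _ => (hg.implicitToOpenPartialHomeomorph_fst hsurj y).symm) (tameBelow_fst _)

end Regular

/-! ### Second-order Taylor inequalities and uniform definiteness. -/

section SecondOrder

variable {E : Type*} [NormedAddCommGroup E] [NormedSpace ℝ E]

/-- Restricted to the segment, `g` minus its first-order part and the parabola `κ * t ^ 2 / 2` has
nonnegative second derivative and zero initial slope, so monotonicity is applied twice. -/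
theorem add_le_of_le_second_derivative {g : E → ℝ} {g' : E → E →L[ℝ] ℝ}
    {g'' : E → E →L[ℝ] E →L[ℝ] ℝ} {a b : E} {κ : ℝ}
    (hg : ∀ y ∈ segment ℝ a b, HasFDerivAt g (g' y) y)
    (hg' : ∀ y ∈ segment ℝ a b, HasFDerivAt g' (g'' y) y)
    (hκ : ∀ y ∈ segment ℝ a b, κ ≤ g'' y (b - a) (b - a)) :
    g a + g' a (b - a) + κ / 2 ≤ g b := by
  set d := b - a with hd
  have hmem : ∀ t ∈ Icc (0 : ℝ) 1, a + t • d ∈ segment ℝ a b := fun t ht => by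
    rw [segment_eq_image']
    exact ⟨t, ht, rfl⟩
  have hline : ∀ t : ℝ, HasDerivAt (fun t : ℝ => a + t • d) d t := fun t => by
    simpa using ((hasDerivAt_id t).smul_const d).const_add a
  have h1 : ∀ t ∈ Icc (0 : ℝ) 1, HasDerivAt
      (fun t : ℝ => g' (a + t • d) d - g' a d - κ * t) (g'' (a + t • d) d d - κ) t := fun t ht => by
    have h : HasDerivAt (fun t : ℝ => g' (a + t • d)) (g'' (a + t • d) d) t :=
      (hg' _ (hmem t ht)).comp_hasDerivAt t (hline t)
    have h' : HasDerivAt (fun t : ℝ => g' (a + t • d) d) (g'' (a + t • d) d d) t := by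
      simpa only [map_zero, add_zero] using h.clm_apply (hasDerivAt_const t d)
    have h2 : HasDerivAt (fun t : ℝ => κ * t) κ t := by
      simpa only [mul_one, id] using (hasDerivAt_id t).const_mul κ
    exact (h'.sub_const (g' a d)).sub h2
  have h0 : ∀ t ∈ Icc (0 : ℝ) 1, HasDerivAt
      (fun t : ℝ => g (a + t • d) - t * g' a d - κ * (t ^ 2 / 2))
      (g' (a + t • d) d - g' a d - κ * t) t := fun t ht => by
    have h : HasDerivAt (fun t : ℝ => g (a + t • d)) (g' (a + t • d) d) t :=
      (hg _ (hmem t ht)).comp_hasDerivAt t (hline t)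
    have h1 : HasDerivAt (fun t : ℝ => t * g' a d) (g' a d) t := by
      simpa only [one_mul, id] using (hasDerivAt_id t).mul_const (g' a d)
    have h2 : HasDerivAt (fun t : ℝ => κ * (t ^ 2 / 2)) (κ * t) t := by
      simpa using (((hasDerivAt_id t).pow 2).div_const 2).const_mul κ
    exact (h.sub h1).sub h2
  have hmono1 : MonotoneOn (fun t : ℝ => g' (a + t • d) d - g' a d - κ * t) (Icc 0 1) := by
    refine monotoneOn_of_deriv_nonneg (convex_Icc 0 1)
      (fun t ht => (h1 t ht).continuousAt.continuousWithinAt)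
      (fun t ht => (h1 t (interior_subset ht)).differentiableAt.differentiableWithinAt) ?_
    intro t ht
    rw [(h1 t (interior_subset ht)).deriv]
    exact sub_nonneg.2 (hκ _ (hmem t (interior_subset ht)))
  have hmono0 : MonotoneOn (fun t : ℝ => g (a + t • d) - t * g' a d - κ * (t ^ 2 / 2))
      (Icc 0 1) := by
    refine monotoneOn_of_deriv_nonneg (convex_Icc 0 1)
      (fun t ht => (h0 t ht).continuousAt.continuousWithinAt)
      (fun t ht => (h0 t (interior_subset ht)).differentiableAt.differentiableWithinAt) ?_
    intro t ht
    rw [(h0 t (interior_subset ht)).deriv]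
    have ht' := interior_subset ht
    have := hmono1 (left_mem_Icc.2 zero_le_one) ht' ht'.1
    simpa using this
  have := hmono0 (left_mem_Icc.2 zero_le_one) (right_mem_Icc.2 zero_le_one) zero_le_one
  simp only [zero_smul, add_zero, one_smul, hd, add_sub_cancel] at this
  linarith

theorem le_add_of_second_derivative_le {g : E → ℝ} {g' : E → E →L[ℝ] ℝ}
    {g'' : E → E →L[ℝ] E →L[ℝ] ℝ} {a b : E} {κ : ℝ}
    (hg : ∀ y ∈ segment ℝ a b, HasFDerivAt g (g' y) y)
    (hg' : ∀ y ∈ segment ℝ a b, HasFDerivAt g' (g'' y) y)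
    (hκ : ∀ y ∈ segment ℝ a b, g'' y (b - a) (b - a) ≤ -κ) :
    g b ≤ g a + g' a (b - a) - κ / 2 := by
  have := add_le_of_le_second_derivative (g := fun y => -g y) (g' := fun y => -g' y)
    (g'' := fun y => -g'' y) (κ := κ) (fun y hy => (hg y hy).neg) (fun y hy => (hg' y hy).neg)
    (fun y hy => by simpa using le_neg.1 (hκ y hy))
  simp only [neg_apply] at this
  linarith

theorem eventually_abs_sub_le_of_continuousAt {H : E → E →L[ℝ] E →L[ℝ] ℝ} {x : E}
    (hH : ContinuousAt H x) {ε : ℝ} (hε : 0 < ε) :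
    ∀ᶠ y in 𝓝 x, ∀ v, |H y v v - H x v v| ≤ ε * ‖v‖ ^ 2 := by
  filter_upwards [hH (Metric.ball_mem_nhds (H x) hε)] with y hy v
  have hn : ‖H y - H x‖ < ε := (dist_eq_norm (H y) (H x)).symm.trans_lt (Metric.mem_ball.1 hy)
  calc |H y v v - H x v v| ≤ ‖H y - H x‖ * ‖v‖ * ‖v‖ := (H y - H x).le_opNorm₂ v v
    _ ≤ ε * ‖v‖ ^ 2 := by
      rw [mul_assoc, ← sq]
      gcongr

/-- Compactness of the unit sphere of `N` gives a positive lower bound at `x`; half of it survives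
perturbing the form. -/
theorem eventually_le_of_pos_on_submodule [FiniteDimensional ℝ E]
    {H : E → E →L[ℝ] E →L[ℝ] ℝ} {x : E} 
    (hH : ∀ ε > 0, ∀ᶠ y in 𝓝 x, ∀ v, |H y v v - H x v v| ≤ ε * ‖v‖ ^ 2) (N : Submodule ℝ E)
    (hpos : ∀ v ∈ N, v ≠ 0 → 0 < H x v v) :
    ∃ κ > 0, ∀ᶠ y in 𝓝 x, ∀ v ∈ N, κ * ‖v‖ ^ 2 ≤ H y v v := by
  have hK : IsCompact (Metric.sphere (0 : E) 1 ∩ N) :=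
    (isCompact_sphere 0 1).inter_right N.closed_of_finiteDimensional
  obtain ⟨κ, hκ, hle⟩ : ∃ κ > 0, ∀ v ∈ Metric.sphere (0 : E) 1 ∩ N, κ ≤ H x v v := by
    rcases (Metric.sphere (0 : E) 1 ∩ N).eq_empty_or_nonempty with h | h
    -- When `N` is trivial its unit sphere is empty and any positive constant works.
    · exact ⟨1, one_pos, by simp [h]⟩
    · obtain ⟨v, hv, hmin⟩ := hK.exists_isMinOn h
        (f := fun v => H x v v) (by fun_prop)
      exact ⟨H x v v, hpos v hv.2 (Metric.ne_of_mem_sphere hv.1 one_ne_zero), fun w hw => hmin hw⟩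
  refine ⟨κ / 2, half_pos hκ, ?_⟩
  filter_upwards [hH (κ / 2) (half_pos hκ)] with y hy v hv
  have h1 : κ * ‖v‖ ^ 2 ≤ H x v v := by
    rcases eq_or_ne v 0 with rfl | hv0
    · simp
    have hn : 0 < ‖v‖ := norm_pos_iff.2 hv0
    have := hle (‖v‖⁻¹ • v) ⟨by simp [norm_smul, hn.ne'], N.smul_mem _ hv⟩
    simp only [map_smul, smul_apply, smul_eq_mul] at this
    calc κ * ‖v‖ ^ 2 ≤ (‖v‖⁻¹ * (‖v‖⁻¹ * H x v v)) * ‖v‖ ^ 2 := by gcongr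
      _ = H x v v := by field_simp
  have h2 := (abs_le.1 (hy v)).1
  linarith

end SecondOrder

/-! ### Local structure of sublevel sets at critical points. -/

section Critical

variable {E : Type*} [NormedAddCommGroup E] [InnerProductSpace ℝ E] [FiniteDimensional ℝ E]

/-- A critical submanifold on which the second derivative is transversally positive definite
consists of local minima. -/
theorem eventually_le_of_critical_submanifold {G : Type*} [NormedAddCommGroup G] [NormedSpace ℝ G]
    [CompleteSpace G] {g : E → ℝ} {g' : E → E →L[ℝ] ℝ} {g'' : E → E →L[ℝ] E →L[ℝ] ℝ} {x : E} {c : ℝ}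
    (hg : ∀ᶠ y in 𝓝 x, HasFDerivAt g (g' y) y) (hg' : ∀ᶠ y in 𝓝 x, HasFDerivAt g' (g'' y) y)
    (hg'' : ContinuousAt g'' x) {ψ : G → E} {ψ' : G →L[ℝ] E} {u : G} (hψ : HasStrictFDerivAt ψ ψ' u)
    (hu : ψ u = x) (hpos : ∀ v ∈ (LinearMap.range ψ'.toLinearMap)ᗮ, v ≠ 0 → 0 < g'' x v v)
    (hcrit : ∀ᶠ w in 𝓝 u, g (ψ w) = c ∧ g' (ψ w) = 0) : ∀ᶠ y in 𝓝 x, c ≤ g y := by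
  set F := LinearMap.range ψ'.toLinearMap with hF
  obtain ⟨κ, hκ, hκ'⟩ := eventually_le_of_pos_on_submodule
    (fun ε hε => eventually_abs_sub_le_of_continuousAt hg'' hε) Fᗮ hpos
  obtain ⟨r, hr, hball⟩ := Metric.eventually_nhds_iff_ball.1 (hg.and (hg'.and hκ'))
  have hψF : HasStrictFDerivAt (fun w => F.orthogonalProjectionOnto (ψ w))
      (F.orthogonalProjectionOnto.comp ψ') u :=
    F.orthogonalProjectionOnto.hasStrictFDerivAt.comp u hψ
  -- Projected to its tangent space `F`, the submanifold covers a neighbourhood. So each `y` near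
  -- `x` differs from some critical point `ψ w` by a vector of `Fᗮ`, along which `g` is convex.
  have hsurj : (F.orthogonalProjectionOnto.comp ψ').range = ⊤ := by
    refine LinearMap.range_eq_top.2 ?_
    rintro ⟨_, w, rfl⟩
    exact ⟨w, Submodule.orthogonalProjectionOnto_mem_subspace_eq_self
      (⟨ψ' w, w, rfl⟩ : LinearMap.range ψ'.toLinearMap)⟩
  have hmap := hψF.map_nhds_eq_of_surj hsurj
  have hS : {w | ψ w ∈ Metric.ball x r ∧ g (ψ w) = c ∧ g' (ψ w) = 0} ∈ 𝓝 u := by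
    refine Filter.Eventually.and ?_ hcrit
    refine hψ.continuousAt.eventually_mem ?_
    rw [hu]
    exact Metric.ball_mem_nhds x hr
  have himg := image_mem_map (m := fun w => F.orthogonalProjectionOnto (ψ w)) hS
  rw [hmap, hu] at himg
  filter_upwards [F.orthogonalProjectionOnto.continuous.continuousAt.preimage_mem_nhds himg,
    Metric.ball_mem_nhds x hr] with y hy hyr
  obtain ⟨w, ⟨hwr, hwc, hw0⟩, hwy⟩ := hy
  have hd : y - ψ w ∈ Fᗮ := by
    rw [← F.orthogonalProjectionOnto_eq_zero_iff, map_sub, sub_eq_zero]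
    exact hwy.symm
  have hseg := (convex_ball x r).segment_subset hwr hyr
  have := add_le_of_le_second_derivative (κ := 0) (fun z hz => (hball z (hseg hz)).1)
    (fun z hz => (hball z (hseg hz)).2.1)
    (fun z hz => le_trans (by positivity) ((hball z (hseg hz)).2.2 _ hd))
  rw [hw0, hwc] at this
  simpa using this

/-- The points of `{g < c}` in a box around `x`, on which `g` is concave along `N` and less than
`c` on the part of the boundary transverse to `N`, form a preconnected set. -/
theorem isPreconnected_box_inter_sublevel {g : E → ℝ} {g' : E → E →L[ℝ] ℝ}
    {g'' : E → E →L[ℝ] E →L[ℝ] ℝ} {x : E} {c r δ : ℝ} {N : Submodule ℝ E}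
    (hN : 2 ≤ Module.finrank ℝ N) (hr : 0 < r) {B : Set E} (hB : Convex ℝ B)
    (hg : ∀ y ∈ B, HasFDerivAt g (g' y) y) (hg' : ∀ y ∈ B, HasFDerivAt g' (g'' y) y)
    (hneg : ∀ y ∈ B, ∀ v ∈ N, g'' y v v ≤ 0) {U : Set E}
    (hU : U = {y | ‖N.starProjection (y - x)‖ ≤ r ∧ ‖y - x - N.starProjection (y - x)‖ < δ})
    (hUB : U ⊆ B) (hS : ∀ y ∈ U, ‖N.starProjection (y - x)‖ = r → g y < c) :
    IsPreconnected (U ∩ {y | g y < c}) := by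
  set S : Set E := {y | ‖N.starProjection (y - x)‖ = r ∧ ‖y - x - N.starProjection (y - x)‖ < δ}
    with hSdef
  have hPN : ∀ v ∈ N, N.starProjection v = v := fun v hv =>
    Submodule.starProjection_eq_self_iff.2 hv
  have hSU : S ⊆ U ∩ {y | g y < c} := fun y hy => by
    have : y ∈ U := by rw [hU]; exact ⟨hy.1.le, hy.2⟩
    exact ⟨this, hS y this hy.1⟩
  -- The face `S` is a sphere in `N` times a ball in `Nᗮ`; the hypothesis `hN` is what makes the
  -- sphere connected.
  have hSpre : IsPreconnected S := by
    have h1 : IsPreconnected (Metric.sphere (0 : N) r) :=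
      isPreconnected_sphere (by
        rw [← Module.finrank_eq_rank]
        exact_mod_cast hN) 0 r
    have h2 : IsPreconnected (Metric.ball (0 : Nᗮ) δ) := (convex_ball 0 δ).isPreconnected
    have h3 := (h1.prod h2).image (fun p : N × Nᗮ => x + p.1 + p.2)
      (by fun_prop)
    convert h3 using 1
    ext y
    constructor
    · rintro ⟨hy1, hy2⟩
      refine ⟨(⟨N.starProjection (y - x), N.starProjection_apply_mem _⟩,
        ⟨y - x - N.starProjection (y - x), N.sub_starProjection_mem_orthogonal _⟩), ⟨?_, ?_⟩, ?_⟩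
      · simpa using hy1
      · simpa using hy2
      · simp
    · rintro ⟨⟨v, w⟩, ⟨hv, hw⟩, rfl⟩
      have : N.starProjection (x + v + w - x) = v := by
        rw [show x + (v : E) + w - x = v + w by abel, map_add, hPN v v.2,
          (Submodule.starProjection_apply_eq_zero_iff N).2 w.2, add_zero]
      refine ⟨?_, ?_⟩
      · rw [this]; simpa using hv
      · rw [this]
        simpa [show x + (v : E) + w - x - v = w by abel] using hw
  -- By concavity along `N`, if `g` is at least `c` at some `q` in the slice through `p`, it keeps
  -- decreasing on the ray from `p` away from `q`. If there is no such `q`, every direction works.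
  have hray : ∀ p ∈ U, g p < c → ∃ d ∈ N, d ≠ 0 ∧ ∀ s : ℝ, 0 ≤ s → p + s • d ∈ U →
      g (p + s • d) < c := by
    intro p hp hpc
    by_cases h : ∃ q ∈ U, p - q ∈ N ∧ c ≤ g q
    · obtain ⟨q, hq, hqN, hqc⟩ := h
      refine ⟨p - q, hqN, ?_, fun s hs hps => ?_⟩
      · intro h0
        rw [sub_eq_zero.1 h0] at hpc
        exact hpc.not_ge hqc
      · have hseg1 := hB.segment_subset (hUB hp) (hUB hq)
        have hseg2 := hB.segment_subset (hUB hp) (hUB hps)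
        have h1 := le_add_of_second_derivative_le (κ := 0) (fun z hz => hg z (hseg1 hz))
          (fun z hz => hg' z (hseg1 hz))
          (fun z hz => by
            rw [neg_zero]
            exact hneg z (hseg1 hz) _ (neg_sub p q ▸ N.neg_mem hqN))
        have h2 := le_add_of_second_derivative_le (κ := 0) (fun z hz => hg z (hseg2 hz))
          (fun z hz => hg' z (hseg2 hz))
          (fun z hz => by
            rw [add_sub_cancel_left, neg_zero]
            exact hneg z (hseg2 hz) _ (N.smul_mem s hqN))
        rw [add_sub_cancel_left, map_smul, smul_eq_mul] at h2
        rw [← neg_sub p q, map_neg] at h1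
        nlinarith
    · push Not at h
      obtain ⟨d, hd⟩ : ∃ d : N, d ≠ 0 := by
        have : Nontrivial N := Module.nontrivial_of_finrank_pos (R := ℝ) (by omega)
        exact exists_ne 0
      refine ⟨d, d.2, by simpa using hd, fun s _ hps => h _ hps ?_⟩
      rw [sub_add_cancel_left]
      exact N.neg_mem (N.smul_mem s d.2)
  have hreach : ∀ p ∈ U ∩ {y | g y < c}, ∃ t ⊆ U ∩ {y | g y < c}, p ∈ t ∧ (t ∩ S).Nonempty ∧
      IsPreconnected t := by
    rintro p ⟨hp, hpc⟩
    obtain ⟨d, hdN, hd0, hd⟩ := hray p hp hpc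
    have hproj : ∀ s : ℝ, N.starProjection (p + s • d - x) = N.starProjection (p - x) + s • d :=
      fun s => by
        rw [show p + s • d - x = (p - x) + s • d by abel, map_add, hPN _ (N.smul_mem s hdN)]
    have hp' := hp
    rw [hU] at hp'
    have hdn : 0 < ‖d‖ := norm_pos_iff.2 hd0
    -- At time `2 * r / ‖d‖` the ray has moved by `2 * r` from a point of norm at most `r`, so it
    -- has reached norm `r` on the way.
    obtain ⟨s, ⟨hs0, -⟩, hs⟩ : r ∈ (fun s : ℝ => ‖N.starProjection (p - x) + s • d‖) ''
        Icc 0 (2 * r / ‖d‖) := by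
      refine intermediate_value_Icc (by positivity) (by fun_prop) ⟨by simpa using hp'.1, ?_⟩
      have h1 : ‖(2 * r / ‖d‖) • d‖ = 2 * r := by
        rw [norm_smul, Real.norm_of_nonneg (by positivity)]
        field_simp
      have h2 := norm_sub_le (N.starProjection (p - x) + (2 * r / ‖d‖) • d)
        (N.starProjection (p - x))
      rw [add_sub_cancel_left, h1] at h2
      have h3 := hp'.1
      linarith
    have hmemU : ∀ s' : ℝ, ‖N.starProjection (p - x) + s' • d‖ ≤ r → p + s' • d ∈ U := by
      intro s' hs'
      rw [hU]
      refine ⟨by rwa [hproj], ?_⟩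
      rw [hproj, show p + s' • d - x - (N.starProjection (p - x) + s' • d) =
        p - x - N.starProjection (p - x) by abel]
      exact hp'.2
    refine ⟨(fun s' : ℝ => p + s' • d) '' Icc 0 s, ?_, ⟨0, ⟨le_rfl, hs0⟩, by simp⟩,
      ⟨p + s • d, ⟨s, ⟨hs0, le_rfl⟩, rfl⟩, ?_⟩,
      isPreconnected_Icc.image _ (by fun_prop)⟩
    · rintro _ ⟨s', hs', rfl⟩
      have hs'U : p + s' • d ∈ U := by
        refine hmemU s' ?_
        -- The times spent in the closed ball form an interval, so the ray stays in the box until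
        -- time `s`.
        have hconv : Convex ℝ {t : ℝ | ‖N.starProjection (p - x) + t • d‖ ≤ r} := by
          intro t ht u hu α β hα hβ hαβ
          have h := convex_closedBall (0 : E) r (mem_closedBall_zero_iff.2 ht)
            (mem_closedBall_zero_iff.2 hu) hα hβ hαβ
          obtain rfl : β = 1 - α := by linarith
          rw [mem_closedBall_zero_iff] at h
          have heq : N.starProjection (p - x) + (α • t + (1 - α) • u) • d =
              α • (N.starProjection (p - x) + t • d) +
                (1 - α) • (N.starProjection (p - x) + u • d) := by
            simp only [smul_eq_mul]
            module
          rwa [mem_ofPred_eq, heq]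
        exact hconv.ordConnected.out (x := 0) (by simpa using hp'.1) (y := s) hs.le hs'
      exact ⟨hs'U, hd s' hs'.1 hs'U⟩
    · have := hmemU s hs.le
      rw [hU] at this
      exact ⟨by rw [hproj]; exact hs, this.2⟩
  rcases (U ∩ {y | g y < c}).eq_empty_or_nonempty with h | ⟨p₀, hp₀⟩
  · rw [h]; exact isPreconnected_empty
  obtain ⟨t₀, -, -, ⟨s₀, -, hs₀⟩, -⟩ := hreach p₀ hp₀
  refine isPreconnected_of_forall s₀ fun p hp => ?_
  obtain ⟨t, htA, hpt, htS, htpre⟩ := hreach p hp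
  exact ⟨t ∪ S, union_subset htA hSU, Or.inr hs₀, Or.inl hpt, htpre.union' htS hSpre⟩

/-- Negative definiteness persists near `x`, so `g` is strictly concave along `N` there. This yields
the box argument at `x`, and at nearby points of the level it gives a direction of strict decrease.
-/
theorem tameBelow_of_neg_on_submodule {g : E → ℝ} {g' : E → E →L[ℝ] ℝ}
    {g'' : E → E →L[ℝ] E →L[ℝ] ℝ} {x : E}
    (hg : ∀ᶠ y in 𝓝 x, HasFDerivAt g (g' y) y) (hg' : ∀ᶠ y in 𝓝 x, HasFDerivAt g' (g'' y) y)
    (hg'' : ContinuousAt g'' x) (hx : g' x = 0) {N : Submodule ℝ E}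
    (hN : 2 ≤ Module.finrank ℝ N) (hneg : ∀ v ∈ N, v ≠ 0 → g'' x v v < 0) : TameBelow g x := by
  obtain ⟨κ, hκ, hκ'⟩ := eventually_le_of_pos_on_submodule (H := fun y => -g'' y)
    (fun ε hε => (eventually_abs_sub_le_of_continuousAt hg'' hε).mono fun y hy => by
      intro v
      have := hy v
      rw [abs_sub_comm] at this
      simpa [sub_eq_add_neg, add_comm] using this) N
    (fun v hv hv0 => by simpa using hneg v hv hv0)
  replace hκ' : ∀ᶠ y in 𝓝 x, ∀ v ∈ N, g'' y v v ≤ -(κ * ‖v‖ ^ 2) :=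
    hκ'.mono fun y hy v hv => le_neg.1 (by simpa using hy v hv)
  have hgood := hg.and (hg'.and hκ')
  obtain ⟨d, hdN, hd0⟩ : ∃ d ∈ N, d ≠ 0 := by
    have : Nontrivial N := Module.nontrivial_of_finrank_pos (R := ℝ) (by omega)
    obtain ⟨d, hd⟩ := exists_ne (0 : N)
    exact ⟨d, d.2, by simpa using hd⟩
  constructor
  · intro W hW
    obtain ⟨R, hR, hball⟩ := Metric.mem_nhds_iff.1 (inter_mem hgood hW)
    have hB := convex_ball x R
    obtain ⟨r, hr, hrR⟩ : ∃ r > 0, 2 * r < R := ⟨R / 3, by positivity, by linarith⟩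
    have hcont : ContinuousOn g (Metric.ball x R) := fun y hy =>
      (hball hy).1.1.continuousAt.continuousWithinAt
    have hO : IsOpen (Metric.ball x R ∩ g ⁻¹' Iio (g x)) :=
      hcont.isOpen_inter_preimage Metric.isOpen_ball isOpen_Iio
    have hK : IsCompact ((fun v : E => x + v) '' (Metric.sphere 0 r ∩ N)) :=
      ((isCompact_sphere 0 r).inter_right N.closed_of_finiteDimensional).image (by fun_prop)
    have hKO : (fun v : E => x + v) '' (Metric.sphere 0 r ∩ N) ⊆
        Metric.ball x R ∩ g ⁻¹' Iio (g x) := by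
      rintro _ ⟨v, ⟨hv, hvN⟩, rfl⟩
      have hvr : ‖v‖ = r := by simpa using hv
      have hvB : x + v ∈ Metric.ball x R := by
        rw [mem_ball_iff_norm, add_sub_cancel_left, hvr]
        linarith
      refine ⟨hvB, ?_⟩
      have hseg := hB.segment_subset (Metric.mem_ball_self hR) hvB
      have := le_add_of_second_derivative_le (κ := κ * ‖v‖ ^ 2) (fun z hz => (hball (hseg hz)).1.1)
        (fun z hz => (hball (hseg hz)).1.2.1)
        (fun z hz => by
          rw [add_sub_cancel_left]
          exact (hball (hseg hz)).1.2.2 v hvN)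
      rw [hx, hvr] at this
      have h2 : 0 < κ * r ^ 2 := by positivity
      rw [zero_apply] at this
      show g (x + v) < g x
      linarith
    obtain ⟨δ, hδ, hthick⟩ := hK.exists_thickening_subset_open hO hKO
    -- The bound `δ` keeps the face of the box below the level of `x`; the bound `r` keeps the box
    -- in the ball of radius `R`, since `2 * r < R`.
    set δ' := min δ r with hδ'
    have hδ'0 : 0 < δ' := lt_min hδ hr
    set U : Set E := {y | ‖N.starProjection (y - x)‖ ≤ r ∧
      ‖y - x - N.starProjection (y - x)‖ < δ'} with hU
    have hUB : U ⊆ Metric.ball x R := fun y hy => by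
      rw [mem_ball_iff_norm]
      have h1 := norm_add_le (N.starProjection (y - x)) (y - x - N.starProjection (y - x))
      rw [add_sub_cancel] at h1
      have h2 := hy.2.trans_le (min_le_right δ r)
      have h3 := hy.1
      linarith
    refine ⟨U, ?_, fun y hy => (hball (hUB hy)).2, ?_⟩
    · have h1 : ∀ᶠ y in 𝓝 x, ‖N.starProjection (y - x)‖ < r :=
        ContinuousAt.eventually_lt (by fun_prop) continuousAt_const (by simpa using hr)
      have h2 : ∀ᶠ y in 𝓝 x, ‖y - x - N.starProjection (y - x)‖ < δ' :=
        ContinuousAt.eventually_lt (by fun_prop) continuousAt_const (by simpa using hδ'0)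
      filter_upwards [h1, h2] with y hy1 hy2 using ⟨hy1.le, hy2⟩
    · refine isPreconnected_box_inter_sublevel hN hr hB (fun y hy => (hball hy).1.1)
        (fun y hy => (hball hy).1.2.1) (fun y hy v hv => ?_) hU hUB ?_
      · have := (hball hy).1.2.2 v hv
        have : 0 ≤ κ * ‖v‖ ^ 2 := by positivity
        linarith
      · intro y hy hyr
        refine (hthick ?_).2
        rw [Metric.mem_thickening_iff]
        refine ⟨x + N.starProjection (y - x), ⟨_, ⟨by simpa using hyr,
          N.starProjection_apply_mem _⟩, rfl⟩, ?_⟩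
        rw [dist_eq_norm, ← sub_sub]
        exact hy.2.trans_le (min_le_left δ r)
  · right
    filter_upwards [eventually_eventually_nhds.2 hgood] with y hy hyx
    obtain ⟨R, hR, hball⟩ := Metric.eventually_nhds_iff_ball.1 hy
    -- The point `y` need not be critical, so the sign of `d` is chosen to make the first-order term
    -- nonpositive; the second-order term is then strictly negative.
    obtain ⟨e, heN, he0, hge⟩ : ∃ e ∈ N, e ≠ 0 ∧ g' y e ≤ 0 := by
      rcases le_total (g' y d) 0 with h | h
      · exact ⟨d, hdN, hd0, h⟩
      · exact ⟨-d, N.neg_mem hdN, neg_ne_zero.2 hd0, by simpa using h⟩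
    have htend : Tendsto (fun t : ℝ => y + t • e) (𝓝[>] 0) (𝓝 y) := by
      have : ContinuousAt (fun t : ℝ => y + t • e) 0 := by fun_prop
      have h2 := this.tendsto
      rw [zero_smul, add_zero] at h2
      exact h2.mono_left nhdsWithin_le_nhds
    refine mem_closure_of_tendsto htend ?_
    filter_upwards [htend.eventually_mem (Metric.ball_mem_nhds y hR), self_mem_nhdsWithin]
      with t ht ht0
    replace ht0 : 0 < t := ht0
    have hseg := (convex_ball y R).segment_subset (Metric.mem_ball_self hR) ht
    have := le_add_of_second_derivative_le (κ := κ * ‖t • e‖ ^ 2)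
      (fun z hz => (hball z (hseg hz)).1) (fun z hz => (hball z (hseg hz)).2.1)
      (fun z hz => by
        rw [add_sub_cancel_left]
        exact (hball z (hseg hz)).2.2 _ (N.smul_mem t heN))
    rw [add_sub_cancel_left, map_smul, smul_eq_mul, hyx] at this
    have h1 : 0 < κ * ‖t • e‖ ^ 2 := by
      have : t • e ≠ 0 := smul_ne_zero ht0.ne' he0
      positivity
    have h2 : t * g' y e ≤ 0 := mul_nonpos_of_nonneg_of_nonpos ht0.le hge
    show g (y + t • e) < g x
    linarith

end Critical

/-! ### Charts, Hessians and the Morse-Bott condition. -/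

section Manifold

variable {n : ℕ} {M : Type*} [TopologicalSpace M] [ChartedSpace (EuclideanSpace ℝ (Fin n)) M]
  {f : M → ℝ} {m : M}

theorem apply_eq_inChart {y : M} (hy : y ∈ (extChartAt (𝓡 n) m).source) :
    f y = inChart n f m (extChartAt (𝓡 n) m y) := by
  rw [inChart, (extChartAt (𝓡 n) m).left_inv hy]

theorem tameBelow_of_inChart (h : TameBelow (inChart n f m) (extChartAt (𝓡 n) m m)) :
    TameBelow f m :=
  .of_openPartialHomeomorph (chartAt (EuclideanSpace ℝ (Fin n)) m) (mem_chart_source _ m)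
    (fun y hy => by simpa using apply_eq_inChart (f := f) (by simpa using hy)) (by simpa using h)

theorem mfderiv_eq_fderiv_inChart (hf : MDifferentiableAt (𝓡 n) 𝓘(ℝ, ℝ) f m) :
    mfderiv (𝓡 n) 𝓘(ℝ, ℝ) f m = fderiv ℝ (inChart n f m) (extChartAt (𝓡 n) m m) := by
  rw [hf.mfderiv]
  simp only [ModelWithCorners.range_eq_univ, fderivWithin_univ]
  rfl

theorem hessianForm_apply (v : EuclideanSpace ℝ (Fin n)) :
    hessianForm n f m v = hessian n f m v v := rfl

theorem exists_submodule_hessian_neg (f : M → ℝ) (m : M) :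
    ∃ N : Submodule ℝ (EuclideanSpace ℝ (Fin n)), Module.finrank ℝ N = index n f m ∧
      ∀ v ∈ N, v ≠ 0 → hessian n f m v v < 0 := by
  obtain ⟨N, hN, hneg⟩ := exists_finrank_eq_sigNeg_and_negDef (hessianForm n f m)
  refine ⟨N, hN, fun v hv hv0 => ?_⟩
  have := hneg ⟨v, hv⟩ (by simpa using hv0)
  simpa [hessianForm_apply] using this

theorem hessian_nonneg_of_index_eq_zero (h : index n f m = 0) (v : EuclideanSpace ℝ (Fin n)) :
    0 ≤ hessian n f m v v := by
  by_contra! hv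
  have hv0 : v ≠ 0 := by
    rintro rfl
    simp at hv
  -- A single negative vector spans a negative definite line, which would force the index to be at
  -- least one.
  have hdef : ((-hessianForm n f m).restrict (Submodule.span ℝ {v})).PosDef := by
    rintro ⟨w, hw⟩ hw0
    obtain ⟨t, rfl⟩ := Submodule.mem_span_singleton.1 hw
    have ht : t ≠ 0 := by
      rintro rfl
      simp at hw0
    have : 0 < -(t * (t * hessian n f m v v)) := by
      rw [← mul_assoc, ← mul_neg]
      exact mul_pos (mul_self_pos.2 ht) (neg_pos.2 hv)
    simpa [hessianForm_apply] using this
  have := le_sigNeg_of_negDef _ hdef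
  rw [finrank_span_singleton hv0] at this
  rw [index] at h
  omega

theorem criticalSet_neg (f : M → ℝ) : criticalSet n (fun x => -f x) = criticalSet n f := by
  ext m
  have h : mfderiv (𝓡 n) 𝓘(ℝ, ℝ) (fun x => -f x) m = -mfderiv (𝓡 n) 𝓘(ℝ, ℝ) f m :=
    mfderiv_neg
  simp only [criticalSet, mem_ofPred_eq, h]
  exact neg_eq_zero

theorem hessian_neg (f : M → ℝ) (m : M) : hessian n (fun x => -f x) m = -hessian n f m := by
  have h1 : inChart n (fun x => -f x) m = -inChart n f m := rfl
  have h2 : fderiv ℝ (-inChart n f m) = -fderiv ℝ (inChart n f m) := by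
    ext1 x
    exact fderiv_neg
  rw [hessian, h1, h2, fderiv_neg, hessian]

theorem index_neg (f : M → ℝ) (m : M) : index n (fun x => -f x) m = coindex n f m := by
  have h : hessianForm n (fun x => -f x) m = -hessianForm n f m := by
    ext v
    simp [hessianForm_apply, hessian_neg]
  rw [index, h, sigNeg_neg, coindex]

theorem IsMorseBott.neg (hf : IsMorseBott n f) : IsMorseBott n (fun x => -f x) := by
  obtain ⟨𝒞, hd, hcrit, h𝒞⟩ := hf.exists_critical_submanifolds
  refine ⟨hf.contMDiff.neg, 𝒞, hd, hcrit.trans (criticalSet_neg f).symm, fun C hC => ?_⟩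
  obtain ⟨hconn, k, cs, im, hemb, hker⟩ := h𝒞 C hC
  refine ⟨hconn, k, cs, im, hemb, fun y => ?_⟩
  rw [← hker y]
  ext v
  change hessian n (fun x => -f x) y.1 v = 0 ↔ hessian n f y.1 v = 0
  rw [hessian_neg]
  exact neg_eq_zero

variable [IsManifold (𝓡 n) ∞ M]

theorem contDiffOn_inChart (hf : ContMDiff (𝓡 n) 𝓘(ℝ, ℝ) ∞ f) (m : M) :
    ContDiffOn ℝ ∞ (inChart n f m) (extChartAt (𝓡 n) m).target :=
  contMDiffOn_iff_contDiffOn.1 (hf.comp_contMDiffOn (contMDiffOn_extChartAt_symm m))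

theorem contDiffAt_inChart (hf : ContMDiff (𝓡 n) 𝓘(ℝ, ℝ) ∞ f) {x : EuclideanSpace ℝ (Fin n)}
    (hx : x ∈ (extChartAt (𝓡 n) m).target) : ContDiffAt ℝ ∞ (inChart n f m) x :=
  (contDiffOn_inChart hf m).contDiffAt ((isOpen_extChartAt_target m).mem_nhds hx)

theorem contDiffAt_fderiv_inChart (hf : ContMDiff (𝓡 n) 𝓘(ℝ, ℝ) ∞ f)
    {x : EuclideanSpace ℝ (Fin n)} (hx : x ∈ (extChartAt (𝓡 n) m).target) :
    ContDiffAt ℝ ∞ (fderiv ℝ (inChart n f m)) x :=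
  (contDiffAt_inChart hf hx).fderiv_right le_rfl

theorem fderiv_inChart_eq_zero (hf : ContMDiff (𝓡 n) 𝓘(ℝ, ℝ) ∞ f)
    {x : EuclideanSpace ℝ (Fin n)} (hx : x ∈ (extChartAt (𝓡 n) m).target)
    (hcrit : (extChartAt (𝓡 n) m).symm x ∈ criticalSet n f) :
    fderiv ℝ (inChart n f m) x = 0 := by
  have h1 : MDifferentiableAt (𝓡 n) 𝓘(ℝ, ℝ) f ((extChartAt (𝓡 n) m).symm x) :=
    (hf _).mdifferentiableAt (by simp)
  have h2 : MDifferentiableAt 𝓘(ℝ, EuclideanSpace ℝ (Fin n)) (𝓡 n)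
      (extChartAt (𝓡 n) m).symm x :=
    ((contMDiffOn_extChartAt_symm (n := ∞) m).contMDiffAt
      ((isOpen_extChartAt_target m).mem_nhds hx)).mdifferentiableAt (by simp)
  have h3 := mfderiv_comp x h1 h2
  have h4 : mfderiv (𝓡 n) 𝓘(ℝ, ℝ) f ((extChartAt (𝓡 n) m).symm x) = 0 := hcrit
  rw [mfderiv_eq_fderiv, h4] at h3
  exact h3.trans (ContinuousLinearMap.zero_comp _)

theorem hessian_symm (hf : ContMDiff (𝓡 n) 𝓘(ℝ, ℝ) ∞ f) (m : M) (v w : EuclideanSpace ℝ (Fin n)) :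
    hessian n f m v w = hessian n f m w v :=
  (contDiffAt_inChart hf (mem_extChartAt_target m)).isSymmSndFDerivAt
    (by rw [minSmoothness_of_isRCLikeNormedField]; exact ENat.LEInfty.out) v w

/-- An isotropic vector of a nonnegative symmetric form lies in its kernel: this is Cauchy-Schwarz,
obtained from the discriminant of `t ↦ H (v + t • w) (v + t • w)`. -/
theorem hessian_apply_eq_zero_of_nonneg (hf : ContMDiff (𝓡 n) 𝓘(ℝ, ℝ) ∞ f)
    (hnonneg : ∀ v, 0 ≤ hessian n f m v v) {v : EuclideanSpace ℝ (Fin n)}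
    (hv : hessian n f m v v = 0) : hessian n f m v = 0 := by
  ext w
  have h : ∀ t : ℝ, 0 ≤ hessian n f m w w * (t * t) + 2 * hessian n f m v w * t + 0 := fun t => by
    have := hnonneg (v + t • w)
    simp only [map_add, map_smul, add_apply, smul_apply, smul_eq_mul, hv,
      hessian_symm hf m w v] at this
    linarith
  have := discrim_le_zero h
  rw [discrim] at this
  have h2 : (hessian n f m v w) ^ 2 ≤ 0 := by linarith
  simpa using le_antisymm h2 (sq_nonneg _)

/-- A critical point of index zero of a Morse-Bott function is a local minimum. -/
theorem IsMorseBott.eventually_le_of_index_eq_zero (hf : IsMorseBott n f)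
    (hm : m ∈ criticalSet n f) (hindex : index n f m = 0) :
    ∀ᶠ x in 𝓝 (extChartAt (𝓡 n) m m), inChart n f m (extChartAt (𝓡 n) m m) ≤ inChart n f m x := by
  obtain ⟨𝒞, -, hcrit, h𝒞⟩ := hf.exists_critical_submanifolds
  obtain ⟨C, hC, hmC⟩ : ∃ C ∈ 𝒞, m ∈ C := by rwa [← hcrit] at hm
  obtain ⟨-, k, _, _, hemb, hker⟩ := h𝒞 C hC
  have hCcrit : ∀ y : C, y.1 ∈ criticalSet n f := fun y => hcrit.subset ⟨C, hC, y.2⟩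
  have hsm := hf.contMDiff
  set p : C := ⟨m, hmC⟩
  set u := extChartAt (𝓡 k) p p
  set ψ := writtenInExtChartAt (𝓡 k) (𝓡 n) p (Subtype.val : C → M) with hψdef
  have hψu : ψ u = extChartAt (𝓡 n) m m := by
    simp only [hψdef, writtenInExtChartAt, Function.comp_apply, u, extChartAt_to_inv]
    rfl
  have hψ : ContDiffAt ℝ ∞ ψ u := by
    have := (contMDiffAt_iff.1 (hemb.contMDiff p)).2
    rwa [ModelWithCorners.range_eq_univ, contDiffWithinAt_univ] at this
  have hdiff : mfderiv (𝓡 k) (𝓡 n) (Subtype.val : C → M) p = fderiv ℝ ψ u := by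
    rw [((hemb.contMDiff p).mdifferentiableAt (by simp)).mfderiv,
      ModelWithCorners.range_eq_univ, fderivWithin_univ]
  have hrange : ∀ v, v ∈ LinearMap.range (fderiv ℝ ψ u).toLinearMap ↔ hessian n f m v = 0 := by
    intro v
    have h : v ∈ hessianKer n f m ↔ v ∈ LinearMap.range
        (mfderiv (𝓡 k) (𝓡 n) (Subtype.val : C → M) p).toLinearMap := by rw [← hker p]
    rw [hdiff] at h
    exact h.symm
  have hnonneg := hessian_nonneg_of_index_eq_zero hindex
  have hgood : ∀ᶠ w in 𝓝 u, ContDiffAt ℝ 1 ψ w ∧ ψ w ∈ (extChartAt (𝓡 n) m).target ∧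
      fderiv ℝ (inChart n f m) (ψ w) = 0 := by
    have h1 : ∀ᶠ w in 𝓝 u, ContDiffAt ℝ 1 ψ w :=
      (hψ.of_le (by exact_mod_cast le_top)).eventually (by simp)
    have h2 : ∀ᶠ w in 𝓝 u, ((extChartAt (𝓡 k) p).symm w).1 ∈ (extChartAt (𝓡 n) m).source := by
      refine (continuous_subtype_val.continuousAt.comp
        (continuousAt_extChartAt_symm p)).eventually_mem ?_
      simp only [Function.comp_apply, extChartAt_to_inv]
      exact extChartAt_source_mem_nhds m
    filter_upwards [h1, h2] with w hw1 hw2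
    have ht : ψ w ∈ (extChartAt (𝓡 n) m).target := (extChartAt (𝓡 n) m).map_source hw2
    refine ⟨hw1, ht, fderiv_inChart_eq_zero hsm ht ?_⟩
    have : (extChartAt (𝓡 n) m).symm (ψ w) = ((extChartAt (𝓡 k) p).symm w).1 :=
      (extChartAt (𝓡 n) m).left_inv hw2
    rw [this]
    exact hCcrit _
  have htgt := extChartAt_target_mem_nhds (I := 𝓡 n) m
  refine eventually_le_of_critical_submanifold (ψ := ψ) (u := u) (ψ' := fderiv ℝ ψ u)
    (g' := fderiv ℝ (inChart n f m)) (g'' := fderiv ℝ (fderiv ℝ (inChart n f m))) ?_ ?_ ?_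
    (hψ.hasStrictFDerivAt (by simp)) hψu ?_ ?_
  · filter_upwards [htgt] with x hx
    exact ((contDiffAt_inChart hsm hx).differentiableAt (by simp)).hasFDerivAt
  · filter_upwards [htgt] with x hx
    exact ((contDiffAt_fderiv_inChart hsm hx).differentiableAt (by simp)).hasFDerivAt
  · exact ((contDiffAt_fderiv_inChart hsm (mem_extChartAt_target m)).fderiv_right
      (m := 0) (by simp)).continuousAt
  -- A vector orthogonal to the critical submanifold with vanishing second derivative lies in the
  -- kernel of the Hessian, hence is tangent by the Morse-Bott condition, hence is zero.
  · intro v hv hv0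
    refine lt_of_le_of_ne (hnonneg v) fun h => hv0 ?_
    have hvr := (hrange v).2 (hessian_apply_eq_zero_of_nonneg hsm hnonneg h.symm)
    exact inner_self_eq_zero.1 (hv v hvr)
  · obtain ⟨r, hr, hball⟩ := Metric.eventually_nhds_iff_ball.1 hgood
    -- The function is constant along the critical submanifold near `m`, since its derivative
    -- vanishes there.
    have hderiv : ∀ w ∈ Metric.ball u r, HasFDerivAt (inChart n f m ∘ ψ)
        (0 : EuclideanSpace ℝ (Fin k) →L[ℝ] ℝ) w := fun w hw => by
      obtain ⟨hw1, hw2, hw3⟩ := hball w hw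
      have h1 := ((contDiffAt_inChart hsm hw2).differentiableAt (by simp)).hasFDerivAt
      have h2 := h1.comp w (hw1.differentiableAt (by simp)).hasFDerivAt
      rwa [hw3, ContinuousLinearMap.zero_comp] at h2
    filter_upwards [Metric.ball_mem_nhds u hr] with w hw
    refine ⟨?_, (hball w hw).2.2⟩
    rw [← hψu]
    exact Metric.isOpen_ball.is_const_of_fderiv_eq_zero (𝕜 := ℝ) (f := inChart n f m ∘ ψ)
      (convex_ball u r).isPreconnected
      (fun z hz => (hderiv z hz).differentiableAt.differentiableWithinAt)
      (fun z hz => (hderiv z hz).fderiv) hw (Metric.mem_ball_self hr)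

/-- The three cases are regular points, index zero and index at least two; only the second needs the
critical set to be a submanifold tangent to the kernel. -/
theorem IsMorseBott.tameBelow (hf : IsMorseBott n f)
    (hindex : ∀ m ∈ criticalSet n f, index n f m ≠ 1) (m : M) : TameBelow f m := by
  have hsm := hf.contMDiff
  have htgt := extChartAt_target_mem_nhds (I := 𝓡 n) m
  have hmem := mem_extChartAt_target (I := 𝓡 n) m
  have hmd := mfderiv_eq_fderiv_inChart (n := n) ((hsm m).mdifferentiableAt (by simp))
  refine tameBelow_of_inChart (n := n) ?_
  by_cases hm : m ∈ criticalSet n f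
  · rcases Nat.eq_zero_or_pos (index n f m) with h0 | hpos
    · exact tameBelow_of_eventually_le (hf.eventually_le_of_index_eq_zero hm h0)
    · obtain ⟨N, hN, hneg⟩ := exists_submodule_hessian_neg (n := n) f m
      have h2 : 2 ≤ Module.finrank ℝ N := by
        have := hindex m hm
        omega
      refine tameBelow_of_neg_on_submodule (g' := fderiv ℝ (inChart n f m))
        (g'' := fderiv ℝ (fderiv ℝ (inChart n f m))) ?_ ?_ ?_ ?_ h2 hneg
      · filter_upwards [htgt] with x hx
        exact ((contDiffAt_inChart hsm hx).differentiableAt (by simp)).hasFDerivAt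
      · filter_upwards [htgt] with x hx
        exact ((contDiffAt_fderiv_inChart hsm hx).differentiableAt (by simp)).hasFDerivAt
      · exact ((contDiffAt_fderiv_inChart hsm hmem).fderiv_right (m := 0) (by simp)).continuousAt
      · exact hmd.symm.trans hm
  · exact tameBelow_of_hasStrictFDerivAt ((contDiffAt_inChart hsm hmem).hasStrictFDerivAt (by simp))
      fun h => hm (hmd.trans h)

end Manifold
end MorseBott

theorem mainTheorem8 {n : ℕ} {M : Type*} [TopologicalSpace M] [T2Space M] [ConnectedSpace M]
    [ChartedSpace (EuclideanSpace ℝ (Fin n)) M] [IsManifold (𝓡 n) ∞ M]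
    (f : M → ℝ) (hf : MorseBott.IsMorseBott n f) (hproper : IsProperMap f)
    (hindex : ∀ m ∈ MorseBott.criticalSet n f, MorseBott.index n f m ≠ 1)
    (hcoindex : ∀ m ∈ MorseBott.criticalSet n f, MorseBott.coindex n f m ≠ 1) (c : ℝ) :
    IsPreconnected (f ⁻¹' {c}) := by
  refine MorseBott.isPreconnected_fiber_of_tameBelow hproper (hf.tameBelow hindex)
    (hf.neg.tameBelow fun m hm => ?_) c
  rw [MorseBott.index_neg]
  exact hcoindex m (MorseBott.criticalSet_neg (n := n) f ▸ hm)
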